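/- Let $d$ be a nonnegative integer, $X=\{x\in\mathbb{R}^d:\|x\|_2\le 1\}$, $\eta\ge 0$, $\varepsilon>0$, and let $\mathcal H$ be the real reproducing kernel Hilbert space over $X$ with kernel $\mathcal K(x,y)=e^{-\eta\|x-y\|_2^2}$. For $x\in X$ let $\mathcal K_x\in\mathcal H$ be the reproducing function at $x$, so that $f(x)=\langle f,\mathcal K_x\rangle_{\mathcal H}$ for all $f\in\mathcal H$. Let $\mathcal B_{\mathrm{HS}}(\mathcal H)$ be the space of Hilbert–Schmidt operators on $\mathcal H$, with Hilbert–Schmidt norm $\|\cdot\|_{\mathrm{HS}}$, and for a bounded operator $T$ on $\mathcal H$ put $$\|T\|_*=\sup_{x\in X}\,|\langle T\mathcal K_x,\mathcal K_x\rangle_{\mathcal H}|.$$ Let $\mathcal N(\varepsilon,I_{\mathrm{HS},*})$ be the $\varepsilon$-covering number of the identity map $I_{\mathrm{HS},*}:(\mathcal B_{\mathrm{HS}}(\mathcal H),\|\cdot\|_{\mathrm{HS}})\to(\mathcal B_{\mathrm{HS}}(\mathcal H),\|\cdot\|_*)$, that is, the smallest cardinality of a set $V\subseteq\mathcal B_{\mathrm{HS}}(\mathcal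 H)$ such that for every $T\in\mathcal B_{\mathrm{HS}}(\mathcal H)$ with $\|T\|_{\mathrm{HS}}\le 1$ there is $v\in V$ with $\|v-T\|_*\le\varepsilon$ (and $\infty$ if no finite such $V$ exists). Then $\mathcal N(\varepsilon,I_{\mathrm{HS},*})$ is finite and $$\ln\mathcal N(\varepsilon,I_{\mathrm{HS},*})\le\left\lceil 2\left(\ln\frac{2\sqrt2}{\varepsilon}+e^2\eta\right)\right\rceil^{2d}\ln\left(1+\frac4\varepsilon\right).$$ -/

import Mathlib

open scoped ENNReal InnerProductSpace

noncomputable section HilbertSchmidtOperators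

variable {H : Type*} [NormedAddCommGroup H] [InnerProductSpace ℝ H]

/-- The sum `∑ ‖T (b i)‖²` along a Hilbert basis `b`, as an extended nonnegative real. -/
def hsSqSum {ι : Type*} (b : HilbertBasis ι ℝ H) (T : H →L[ℝ] H) : ℝ≥0∞ :=
  ∑' i, ‖T (b i)‖ₑ ^ 2

theorem enorm_sq_eq_tsum_inner {ι : Type*} (b : HilbertBasis ι ℝ H) (x : H) :
    ‖x‖ₑ ^ 2 = ∑' i, ‖⟪x, b i⟫_ℝ‖ₑ ^ 2 := by
  have h := b.hasSum_inner_mul_inner x x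
  have h2 : ∀ i, ⟪x, b i⟫_ℝ * ⟪b i, x⟫_ℝ = ‖⟪x, b i⟫_ℝ‖ ^ 2 := fun i => by
    rw [real_inner_comm x (b i), Real.norm_eq_abs, sq_abs, sq]
  simp only [h2] at h
  rw [real_inner_self_eq_norm_sq] at h
  have h3 := ENNReal.ofReal_tsum_of_nonneg (fun i => by positivity) h.summable
  rw [h.tsum_eq] at h3
  simp only [ENNReal.ofReal_pow (norm_nonneg _), ofReal_norm] at h3
  exact h3

theorem hsSqSum_eq_adjoint [CompleteSpace H] {ι κ : Type*} (b : HilbertBasis ι ℝ H)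
    (c : HilbertBasis κ ℝ H) (T : H →L[ℝ] H) :
    hsSqSum b T = hsSqSum c (ContinuousLinearMap.adjoint T) := by
  simp only [hsSqSum]
  calc ∑' i, ‖T (b i)‖ₑ ^ 2 = ∑' i, ∑' j, ‖⟪T (b i), c j⟫_ℝ‖ₑ ^ 2 :=
        tsum_congr fun i => enorm_sq_eq_tsum_inner c _
    _ = ∑' j, ∑' i, ‖⟪T (b i), c j⟫_ℝ‖ₑ ^ 2 := ENNReal.tsum_comm
    _ = ∑' j, ‖ContinuousLinearMap.adjoint T (c j)‖ₑ ^ 2 :=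
        tsum_congr fun j => by
          rw [enorm_sq_eq_tsum_inner b]
          refine tsum_congr fun i => ?_
          rw [ContinuousLinearMap.adjoint_inner_left, real_inner_comm]

/-- The sum `∑ ‖T (b i)‖²` does not depend on the Hilbert basis. -/
theorem hsSqSum_eq [CompleteSpace H] {ι κ : Type*} (b : HilbertBasis ι ℝ H)
    (c : HilbertBasis κ ℝ H) (T : H →L[ℝ] H) : hsSqSum b T = hsSqSum c T := by
  rw [hsSqSum_eq_adjoint b b T, ← hsSqSum_eq_adjoint c b T]

variable (H) [CompleteSpace H]

/-- Index set of a fixed Hilbert basis of `H`. -/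
def hsIndex : Set H := (exists_hilbertBasis ℝ H).choose

/-- A fixed Hilbert basis of `H`; by `hsSqSum_eq` its choice is immaterial. -/
def hsBasis : HilbertBasis (hsIndex H) ℝ H := (exists_hilbertBasis ℝ H).choose_spec.choose

theorem memℓp_two_iff_hsSqSum (T : H →L[ℝ] H) :
    Memℓp (fun i => T (hsBasis H i)) 2 ↔ hsSqSum (hsBasis H) T ≠ ∞ := by
  rw [memℓp_gen_iff (by norm_num)]
  have : ∀ i, ‖T (hsBasis H i)‖ₑ ^ 2 = ENNReal.ofReal (‖T (hsBasis H i)‖ ^ 2) := fun i => by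
    rw [ENNReal.ofReal_pow (norm_nonneg _), ofReal_norm]
  simp only [hsSqSum, this, ENNReal.toReal_ofNat, Real.rpow_ofNat]
  constructor
  · intro h
    rw [← ENNReal.ofReal_tsum_of_nonneg (fun i => by positivity) h]
    exact ENNReal.ofReal_ne_top
  · intro h
    simpa using ENNReal.summable_toReal h

/-- The Hilbert–Schmidt operators on `H`, as a subspace of the bounded operators: those with
`∑ ‖T (b i)‖² < ∞`. -/
def hsSubmodule : Submodule ℝ (H →L[ℝ] H) where
  carrier := {T | Memℓp (fun i => T (hsBasis H i)) 2}
  zero_mem' := zero_memℓp (E := fun _ : hsIndex H => H) (p := 2)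
  add_mem' hS hT := Memℓp.add hS hT
  smul_mem' c _ hT := Memℓp.const_smul hT c

/-- The space of Hilbert–Schmidt operators on `H`. It is a new type, so that its norm below is the
Hilbert–Schmidt norm and not the operator norm. -/
def HilbertSchmidt : Type _ := hsSubmodule H

namespace HilbertSchmidt

instance : AddCommGroup (HilbertSchmidt H) := inferInstanceAs (AddCommGroup (hsSubmodule H))

instance : Module ℝ (HilbertSchmidt H) := inferInstanceAs (Module ℝ (hsSubmodule H))

/-- The inclusion of the Hilbert–Schmidt operators into the bounded operators. -/
def toCLM : HilbertSchmidt H →ₗ[ℝ] H →L[ℝ] H := (hsSubmodule H).subtype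

/-- The embedding `T ↦ (T (b i))ᵢ` into the Hilbert sum of copies of `H`. -/
def toL2 : HilbertSchmidt H →ₗ[ℝ] lp (fun _ : hsIndex H => H) 2 where
  toFun T := ⟨fun i => toCLM H T (hsBasis H i), T.2⟩
  map_add' _ _ := rfl
  map_smul' _ _ := rfl

theorem toCLM_injective : Function.Injective (toCLM H) := Subtype.coe_injective

theorem toL2_injective : Function.Injective (toL2 H) := by
  intro S T h
  apply toCLM_injective H
  have h1 : ∀ i, toCLM H S (hsBasis H i) = toCLM H T (hsBasis H i) := fun i =>
    congrFun (congrArg Subtype.val h) i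
  refine ContinuousLinearMap.ext_on (s := Set.range (hsBasis H)) ?_ ?_
  · exact Submodule.dense_iff_topologicalClosure_eq_top.mpr (hsBasis H).dense_span
  · rintro _ ⟨i, rfl⟩
    exact h1 i

/-- The Hilbert–Schmidt norm. -/
instance : NormedAddCommGroup (HilbertSchmidt H) :=
  NormedAddCommGroup.induced _ _ (toL2 H) (toL2_injective H)

/-- The Hilbert–Schmidt inner product `⟪S, T⟫ = ∑ ⟪S (b i), T (b i)⟫`. -/
instance : InnerProductSpace ℝ (HilbertSchmidt H) where
  norm_smul_le c T := by
    change ‖toL2 H (c • T)‖ ≤ ‖c‖ * ‖toL2 H T‖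
    rw [map_smul, norm_smul]
  inner S T := ⟪toL2 H S, toL2 H T⟫_ℝ
  norm_sq_eq_re_inner T := norm_sq_eq_re_inner (𝕜 := ℝ) (toL2 H T)
  conj_inner_symm S T := inner_conj_symm (𝕜 := ℝ) (toL2 H S) (toL2 H T)
  add_left S T U := by simp [inner_add_left]
  smul_left S T c := by simp [inner_smul_left]

/-- The Hilbert–Schmidt operators are those with `∑ ‖T (b i)‖² < ∞` along any Hilbert basis. -/
theorem mem_hsSubmodule_iff {ι : Type*} (b : HilbertBasis ι ℝ H) (T : H →L[ℝ] H) :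
    T ∈ hsSubmodule H ↔ hsSqSum b T ≠ ∞ := by
  rw [hsSqSum_eq b (hsBasis H) T]
  exact memℓp_two_iff_hsSqSum H T

/-- Along any Hilbert basis, the squared Hilbert–Schmidt norm is `∑ ‖T (b i)‖²`. -/
theorem enorm_sq_eq {ι : Type*} (b : HilbertBasis ι ℝ H) (T : HilbertSchmidt H) :
    ‖T‖ₑ ^ 2 = hsSqSum b (toCLM H T) := by
  rw [hsSqSum_eq b (hsBasis H)]
  have h := lp.hasSum_norm (p := 2) (by norm_num) (toL2 H T)
  simp only [ENNReal.toReal_ofNat, Real.rpow_ofNat] at h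
  have h3 := ENNReal.ofReal_tsum_of_nonneg (fun i => by positivity) h.summable
  rw [h.tsum_eq] at h3
  simp only [ENNReal.ofReal_pow (norm_nonneg _), ofReal_norm] at h3
  exact h3

end HilbertSchmidt

end HilbertSchmidtOperators

noncomputable section ReproducingKernel

variable (H : Type*) {X : Type*} [NormedAddCommGroup H] [InnerProductSpace ℝ H]
  [CompleteSpace H] [RKHS ℝ H X ℝ]

/-- The reproducing function `K_x ∈ H`, with `⟪f, K_x⟫ = f x` for every `f`. -/
def reproducingFun (x : X) : H := RKHS.kerFun H x 1

theorem inner_reproducingFun (f : H) (x : X) : ⟪f, reproducingFun H x⟫_ℝ = f x := by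
  simp [reproducingFun]

/-- The real-valued reproducing kernel `K(x, y)` of `H`. -/
def realKernel (x y : X) : ℝ := RKHS.kernel H x y 1

theorem reproducingFun_apply (x y : X) : reproducingFun H x y = realKernel H y x :=
  RKHS.kerFun_apply H x 1 y

variable {H}

/-- The norm `‖T‖_* = sup_x |⟪T K_x, K_x⟫|` of a bounded operator. -/
def starNorm (T : H →L[ℝ] H) : ℝ :=
  ⨆ x : X, |⟪T (reproducingFun H x), reproducingFun H x⟫_ℝ|

/-- If the kernel is bounded on the diagonal, the supremum in `starNorm` is over a bounded set. -/
theorem bddAbove_starNorm {C : ℝ} (hC : ∀ x : X, realKernel H x x ≤ C) (T : H →L[ℝ] H) :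
    BddAbove (Set.range fun x : X => |⟪T (reproducingFun H x), reproducingFun H x⟫_ℝ|) := by
  refine ⟨‖T‖ * C, ?_⟩
  rintro _ ⟨x, rfl⟩
  have h1 : ‖reproducingFun H x‖ * ‖reproducingFun H x‖ ≤ C := by
    rw [← real_inner_self_eq_norm_mul_norm, inner_reproducingFun, reproducingFun_apply]
    exact hC x
  calc |⟪T (reproducingFun H x), reproducingFun H x⟫_ℝ|
      ≤ ‖T (reproducingFun H x)‖ * ‖reproducingFun H x‖ := abs_real_inner_le_norm _ _
    _ ≤ ‖T‖ * ‖reproducingFun H x‖ * ‖reproducingFun H x‖ := by gcongr; exact T.le_opNorm _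
    _ ≤ ‖T‖ * C := by rw [mul_assoc]; gcongr

end ReproducingKernel

noncomputable section Covering

/-- The `ε`-covering number of a linear map `T : (E, p) → (F, q)`, where `p` and `q` are the norms
considered on `E` and `F`: the least cardinality of a set `V ⊆ F` such that every `T x` with
`p x ≤ 1` is within `q`-distance `ε` of a point of `V`, and `⊤` if there is no such finite set. -/
def operatorCoveringNumber {E F : Type*} [AddCommGroup E] [Module ℝ E] [AddCommGroup F]
    [Module ℝ F] (p : E → ℝ) (q : F → ℝ) (ε : ℝ) (T : E →ₗ[ℝ] F) : ℕ∞ :=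
  ⨅ (V : Set F) (_ : ∀ x : E, p x ≤ 1 → ∃ v ∈ V, q (v - T x) ≤ ε), V.encard

/-- The `ε`-covering number of the identity from the Hilbert–Schmidt operators on the RKHS `H` with
the Hilbert–Schmidt norm to the Hilbert–Schmidt operators with the norm `‖·‖_*`. -/
def hsStarCoveringNumber (H : Type*) {X : Type*} [NormedAddCommGroup H] [InnerProductSpace ℝ H]
    [CompleteSpace H] [RKHS ℝ H X ℝ] (ε : ℝ) : ℕ∞ :=
  operatorCoveringNumber (fun T : HilbertSchmidt H => ‖T‖)
    (fun T : HilbertSchmidt H => starNorm (HilbertSchmidt.toCLM H T)) ε LinearMap.id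

end Covering

/-!
The kernel `exp (-η ‖x - y‖²)` has the feature map `φ : X → ℓ²(ℕᵈ)` obtained by expanding
`exp (2 η ⟪x, y⟫)` in monomials. It induces an embedding `J : H → ℓ²`, so the features are
represented by functions `h α = J† e_α` in `H` that satisfy Bessel's inequality
(`exists_bessel_family_of_hasSum_kernel`). The squares `φ_α(x)²` are the probabilities of
independent Poisson variables of total mean `2 η ‖x‖²`, and a Chernoff bound
(`one_sub_sum_gaussFeature_sq_le`) shows that the features in the box `[0, n)ᵈ` approximate each
reproducing function with squared error at most `exp (2 e² η - 2 n)`.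

For `n = ⌈2 (ln (2√2 / ε) + e² η)⌉` and `ε < 1` that error is at most `(ε / 8)²`. Hence, up to
`ε / 2`, the norm `‖S‖_*` of an operator of Hilbert–Schmidt norm at most `2` is controlled by the
Euclidean norm of its matrix `⟪S (h β), h α⟫` of size `nᵈ × nᵈ`. Compression to this matrix is a
contraction (`HilbertSchmidt.norm_compression_le`), so the unit ball is sent into a Euclidean unit
ball of dimension `n²ᵈ`. There the image has an `ε / 2`-net of at most `(1 + 4 / ε) ^ n²ᵈ` of its
own points, by volume comparison (`exists_finite_net_of_subset_unitBall`), and preimages of these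
points form an `ε`-net (`hsStarCoveringNumber_le_of_approx`). For `ε ≥ 1` the zero operator is
a net by itself.
-/

/-! ### Packings of the unit ball -/

open MeasureTheory Metric Module in
/-- Volume comparison: the balls of radius `r / 2` about the points of an `r`-separated subset of
the unit ball are disjoint and lie in the ball of radius `1 + r / 2`. -/
theorem card_le_of_separated_unitBall {E : Type*} [NormedAddCommGroup E] [NormedSpace ℝ E]
    [FiniteDimensional ℝ E] {r : ℝ} (hr : 0 < r) (s : Finset E) (hs : ∀ c ∈ s, ‖c‖ ≤ 1)
    (h : ∀ c ∈ s, ∀ d ∈ s, c ≠ d → r ≤ ‖c - d‖) :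
    (s.card : ℝ) ≤ (1 + 2 / r) ^ finrank ℝ E := by
  borelize E
  let μ : Measure E := Measure.addHaar
  have hδ : 0 < r / 2 := by positivity
  have hρ : 0 < 1 + r / 2 := by positivity
  have hdisj : Set.Pairwise (s : Set E) (Function.onFun Disjoint fun c => ball c (r / 2)) := by
    intro c hc d hd hcd
    apply ball_disjoint_ball
    rw [dist_eq_norm]
    linarith [h c hc d hd hcd]
  have hsub : ⋃ c ∈ s, ball c (r / 2) ⊆ ball (0 : E) (1 + r / 2) := by
    refine Set.iUnion₂_subset fun c hc => ball_subset_ball' ?_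
    rw [dist_zero_right]
    linarith [hs c hc]
  have hvol := measure_mono (μ := μ) hsub
  rw [measure_biUnion_finset hdisj fun c _ => measurableSet_ball] at hvol
  simp only [μ.addHaar_ball_of_pos _ hδ, μ.addHaar_ball_of_pos _ hρ, Finset.sum_const,
    nsmul_eq_mul, ← mul_assoc] at hvol
  have hcard := (ENNReal.mul_le_mul_iff_left (measure_ball_pos μ _ zero_lt_one).ne'
    measure_ball_lt_top.ne).1 hvol
  have hreal := ENNReal.toReal_le_of_le_ofReal (pow_nonneg hρ.le _) hcard
  rw [ENNReal.toReal_mul, ENNReal.toReal_natCast, ENNReal.toReal_ofReal (by positivity)] at hreal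
  have hfac : 1 + r / 2 = (1 + 2 / r) * (r / 2) := by field_simp; ring
  rw [hfac, mul_pow] at hreal
  exact le_of_mul_le_mul_right hreal (by positivity)

open Metric Module in
/-- A subset of the unit ball has an `r`-net of at most `(1 + 2 / r) ^ dim` of its own points. -/
theorem exists_finite_net_of_subset_unitBall {E : Type*} [NormedAddCommGroup E]
    [NormedSpace ℝ E] [FiniteDimensional ℝ E] {r : ℝ} (hr : 0 < r) (S : Set E)
    (hS : ∀ x ∈ S, ‖x‖ ≤ 1) :
    ∃ C ⊆ S, C.Finite ∧ (C.ncard : ℝ) ≤ (1 + 2 / r) ^ finrank ℝ E ∧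
      ∀ x ∈ S, ∃ c ∈ C, ‖c - x‖ ≤ r := by
  lift r to NNReal using hr.le
  have hsep (C : Finset E) (hC : ↑C ⊆ S) (hC' : IsSeparated r (C : Set E)) :
      (C.card : ℝ) ≤ (1 + 2 / (r : ℝ)) ^ finrank ℝ E := by
    refine card_le_of_separated_unitBall hr C (fun c hc => hS c (hC hc)) fun c hc d hd hcd => ?_
    have : (r : ENNReal) < edist c d := hC' hc hd hcd
    rw [edist_dist, ENNReal.lt_ofReal_iff_toReal_lt (by simp), dist_eq_norm] at this
    exact this.le
  have hpack : packingNumber r S ≤ (⌊(1 + 2 / (r : ℝ)) ^ finrank ℝ E⌋₊ : ℕ∞) := by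
    refine iSup_le fun C => iSup₂_le fun hC hC' => ?_
    by_contra! hlt
    obtain ⟨t, htC, ht⟩ := Set.exists_subset_encard_eq (Order.add_one_le_of_lt hlt)
    have htfin : t.Finite := Set.finite_of_encard_eq_coe (k := _ + 1) (by rw [ht]; norm_cast)
    have h1 := hsep htfin.toFinset (by simpa using htC.trans hC) (by simpa using hC'.subset htC)
    have h2 := Nat.le_floor h1
    rw [htfin.encard_eq_coe_toFinset_card] at ht
    norm_cast at ht
    push_cast at ht h2
    omega
  have hcov := (coveringNumber_le_packingNumber r S).trans hpack
  obtain ⟨C, hCS, hCfin, hC, hcard⟩ := exists_set_encard_eq_coveringNumber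
    (ne_top_of_le_ne_top (ENat.natCast_ne_top _) hcov)
  refine ⟨C, hCS, hCfin, ?_, fun x hx => ?_⟩
  · rw [← hcard, ← hCfin.cast_ncard_eq] at hcov
    exact (Nat.le_floor_iff (by positivity)).1 (by exact_mod_cast hcov)
  · obtain ⟨c, hc, hcx⟩ := hC hx
    refine ⟨c, hc, ?_⟩
    have : edist x c ≤ r := hcx
    rw [edist_dist, ENNReal.ofReal_le_iff_le_toReal (by simp), dist_comm, dist_eq_norm] at this
    exact this

/-! ### The Taylor features of the Gaussian kernel -/

theorem hasSum_pi_prod {d : ℕ} {f : Fin d → ℕ → ℝ} {a : Fin d → ℝ}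
    (h : ∀ i, HasSum (f i) (a i)) :
    HasSum (fun α : Fin d → ℕ => ∏ i, f i (α i)) (∏ i, a i) := by
  induction d with
  | zero => simp
  | succ d ih =>
    have ht := ih fun i => h i.succ
    have h0 : Summable fun n => ‖f 0 n‖ := (h 0).summable.norm
    have h1 : Summable fun β : Fin d → ℕ => ‖∏ i, f i.succ (β i)‖ := ht.summable.norm
    have hs := summable_mul_of_summable_norm h0 h1
    have hmul := (h 0).mul ht hs
    rw [← (Fin.consEquiv fun _ : Fin (d + 1) => ℕ).hasSum_iff, Fin.prod_univ_succ]
    simpa [Function.comp_def, Fin.prod_univ_succ, Fin.consEquiv] using hmul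

/-- The feature of multi-index `α` of the Gaussian kernel `exp (-η ‖x - y‖²)`: the monomial
`∏ (√(2 η) x i) ^ α i`, normalized by `√(α!)` and multiplied by `exp (-η ‖x‖²)`. Its square is
`exp (-2 η ‖x‖²)` times the `α`-th term in the expansion of `exp (2 η ⟪x, x⟫)`. -/
noncomputable def gaussFeature {d : ℕ} (η : ℝ) (x : EuclideanSpace ℝ (Fin d)) (α : Fin d → ℕ) :
    ℝ :=
  Real.exp (-η * ‖x‖ ^ 2) * ∏ i, (√(2 * η) * x i) ^ α i / √((α i).factorial : ℝ)

/-- The generating function of the Taylor features. At `t = 1` it says that they are features of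
the Gaussian kernel; for `x = y` and `t > 1` it is the exponential moment behind the tail bound. -/
theorem hasSum_gaussFeature {d : ℕ} {η : ℝ} (hη : 0 ≤ η) (t : ℝ)
    (x y : EuclideanSpace ℝ (Fin d)) :
    HasSum (fun α : Fin d → ℕ => t ^ (∑ i, α i) * (gaussFeature η x α * gaussFeature η y α))
      (Real.exp (-η * ‖x‖ ^ 2 - η * ‖y‖ ^ 2 + 2 * η * t * ⟪x, y⟫_ℝ)) := by
  have hexp (i : Fin d) : HasSum (fun n : ℕ => (2 * η * t * (x i * y i)) ^ n / n.factorial)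
      (Real.exp (2 * η * t * (x i * y i))) := by
    rw [Real.exp_eq_exp_ℝ]
    exact NormedSpace.expSeries_div_hasSum_exp _
  have hprod := (hasSum_pi_prod hexp).mul_left (Real.exp (-η * ‖x‖ ^ 2) * Real.exp (-η * ‖y‖ ^ 2))
  have hval : Real.exp (-η * ‖x‖ ^ 2) * Real.exp (-η * ‖y‖ ^ 2)
      * ∏ i, Real.exp (2 * η * t * (x i * y i))
      = Real.exp (-η * ‖x‖ ^ 2 - η * ‖y‖ ^ 2 + 2 * η * t * ⟪x, y⟫_ℝ) := by
    rw [← Real.exp_sum, ← Real.exp_add, ← Real.exp_add, ← Finset.mul_sum, PiLp.inner_apply]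
    congr 1
    simp only [RCLike.inner_apply, conj_trivial, mul_comm (y _)]
    ring
  rw [hval] at hprod
  have hterm (α : Fin d → ℕ) (i : Fin d) : (2 * η * t * (x i * y i)) ^ α i / (α i).factorial
      = t ^ α i * ((√(2 * η) * x i) ^ α i / √((α i).factorial : ℝ)
        * ((√(2 * η) * y i) ^ α i / √((α i).factorial : ℝ))) := by
    rw [div_mul_div_comm, Real.mul_self_sqrt (Nat.cast_nonneg _), ← mul_pow, ← mul_div_assoc,
      ← mul_pow]
    congr 2
    linear_combination (-t * x i * y i) * Real.mul_self_sqrt (show 0 ≤ 2 * η by positivity)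
  refine (congrArg (HasSum · _) (funext fun α => ?_)).mpr hprod
  simp only [gaussFeature, hterm, Finset.prod_mul_distrib, Finset.prod_pow_eq_pow_sum]
  ring

theorem hasSum_gaussFeature_mul {d : ℕ} {η : ℝ} (hη : 0 ≤ η) (x y : EuclideanSpace ℝ (Fin d)) :
    HasSum (fun α : Fin d → ℕ => gaussFeature η x α * gaussFeature η y α)
      (Real.exp (-η * ‖x - y‖ ^ 2)) := by
  have h := hasSum_gaussFeature hη 1 x y
  simp only [one_pow, one_mul] at h
  rw [norm_sub_sq_real]
  convert h using 2
  ring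

/-- Chernoff bound: `α ↦ gaussFeature η x α ^ 2` is the law of independent Poisson variables of
total mean `2 η ‖x‖² ≤ 2 η`, and outside the box `∏ [0, n)` the total degree is at least `n`.
The exponential moment is taken at `t = e²`. -/
theorem one_sub_sum_gaussFeature_sq_le {d : ℕ} {η : ℝ} (hη : 0 ≤ η)
    {x : EuclideanSpace ℝ (Fin d)} (hx : ‖x‖ ≤ 1) (n : ℕ) :
    1 - ∑ α ∈ Fintype.piFinset fun _ : Fin d => Finset.range n, gaussFeature η x α ^ 2
      ≤ Real.exp (2 * (Real.exp 1 ^ 2 * η) - 2 * n) := by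
  set B := Fintype.piFinset fun _ : Fin d => Finset.range n
  have h1 : HasSum (fun α => gaussFeature η x α ^ 2) 1 := by
    simpa [sq] using hasSum_gaussFeature_mul hη x x
  have hB : HasSum (fun α => if α ∈ B then gaussFeature η x α ^ 2 else 0)
      (∑ α ∈ B, gaussFeature η x α ^ 2) := by
    have := hasSum_sum_of_ne_finset_zero (s := B) (L := .unconditional _)
      (f := fun α => if α ∈ B then gaussFeature η x α ^ 2 else 0) fun α hα => if_neg hα
    rwa [Finset.sum_congr rfl fun α hα => if_pos hα] at this
  have ht := (hasSum_gaussFeature hη (Real.exp 2) x x).mul_left (Real.exp (-(2 * n)))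
  refine (hasSum_le (fun α => ?_) (h1.sub hB) ht).trans ?_
  · by_cases hα : α ∈ B
    · simp only [hα, if_true, sub_self]
      exact mul_nonneg (by positivity) (mul_nonneg (by positivity) (mul_self_nonneg _))
    · obtain ⟨i, hi⟩ : ∃ i, n ≤ α i := by simpa [B] using hα
      have hn : (n : ℝ) ≤ ((∑ i, α i : ℕ) : ℝ) := by
        exact_mod_cast hi.trans (Finset.single_le_sum (fun _ _ => Nat.zero_le _)
          (Finset.mem_univ i))
      rw [if_neg hα, sub_zero, ← mul_assoc, ← sq, ← Real.exp_nat_mul, ← Real.exp_add]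
      exact le_mul_of_one_le_left (sq_nonneg _) (Real.one_le_exp (by linarith))
  · rw [← Real.exp_add, Real.exp_le_exp, real_inner_self_eq_norm_sq,
      show Real.exp 2 = Real.exp 1 ^ 2 by rw [← Real.exp_nat_mul]; norm_num]
    have h2 : ‖x‖ ^ 2 ≤ 1 := pow_le_one₀ (norm_nonneg _) hx
    have h3 : Real.exp 1 ^ 2 * η * ‖x‖ ^ 2 ≤ Real.exp 1 ^ 2 * η :=
      mul_le_of_le_one_right (by positivity) h2
    have h4 : 0 ≤ η * ‖x‖ ^ 2 := by positivity
    linarith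

/-! ### Features of a reproducing kernel -/

section Features

variable {H X : Type*} [NormedAddCommGroup H] [InnerProductSpace ℝ H] [CompleteSpace H]
  [RKHS ℝ H X ℝ]

theorem inner_reproducingFun_reproducingFun (x y : X) :
    ⟪reproducingFun H x, reproducingFun H y⟫_ℝ = realKernel H y x := by
  rw [inner_reproducingFun, reproducingFun_apply]

variable (H) in
theorem denseRange_linearCombination_reproducingFun :
    DenseRange (Finsupp.linearCombination ℝ (reproducingFun H : X → H)) := by
  have hdense := Submodule.dense_iff_topologicalClosure_eq_top.mpr (RKHS.kerFun_dense (𝕜 := ℝ) H)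
  refine hdense.mono ?_
  rw [← LinearMap.coe_range, Finsupp.range_linearCombination]
  refine Submodule.span_le.2 ?_
  rintro _ ⟨x, v, rfl⟩
  have : RKHS.kerFun H x v = v • reproducingFun H x := by
    rw [reproducingFun, ← map_smul, smul_eq_mul, mul_one]
  rw [this]
  exact Submodule.smul_mem _ _ (Submodule.subset_span ⟨x, rfl⟩)

/-- A feature map of the kernel of `H` factors through a contraction of `H` (in fact an isometric
embedding) that sends each reproducing function to the corresponding feature vector. -/
theorem exists_clm_reproducingFun_eq {F : Type*} [NormedAddCommGroup F] [InnerProductSpace ℝ F]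
    [CompleteSpace F] (φ : X → F) (hφ : ∀ x y, ⟪φ x, φ y⟫_ℝ = realKernel H x y) :
    ∃ J : H →L[ℝ] F, ‖J‖ ≤ 1 ∧ ∀ x, J (reproducingFun H x) = φ x := by
  set e := Finsupp.linearCombination ℝ (reproducingFun H : X → H)
  set f := Finsupp.linearCombination ℝ φ
  have hnorm (c : X →₀ ℝ) : ‖f c‖ ≤ 1 * ‖e c‖ := by
    rw [one_mul, ← sq_le_sq₀ (norm_nonneg _) (norm_nonneg _), ← real_inner_self_eq_norm_sq,
      ← real_inner_self_eq_norm_sq]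
    simp only [e, f, Finsupp.linearCombination_apply, Finsupp.sum, sum_inner, inner_sum,
      real_inner_smul_left, real_inner_smul_right, hφ, inner_reproducingFun_reproducingFun]
    rw [Finset.sum_comm]
    exact (Finset.sum_congr rfl fun x _ => Finset.sum_congr rfl fun y _ => by ring).le
  have hd := denseRange_linearCombination_reproducingFun (X := X) H
  refine ⟨f.extendOfNorm e, LinearMap.opNorm_extendOfNorm_le hd zero_le_one hnorm, fun x => ?_⟩
  simpa [e, f] using LinearMap.extendOfNorm_eq hd ⟨1, hnorm⟩ (Finsupp.single x 1)

/-- If `K(x, y) = ∑ φ_α(x) φ_α(y)` then the features `φ_α` are represented by functions `h α ∈ H`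
satisfying Bessel's inequality, and the partial sums `∑ φ_α(x) h α` approximate the reproducing
function at `x` with squared error the tail of the series for `K(x, x)`. In fact `h α` is the image
of the basis vector `α` of `ℓ²` under the adjoint of the embedding `H → ℓ²` given by `φ`. -/
theorem exists_bessel_family_of_hasSum_kernel {ι : Type*} (φ : X → ι → ℝ)
    (hφ : ∀ x y, HasSum (fun α => φ x α * φ y α) (realKernel H x y)) :
    ∃ h : ι → H, (∀ (s : Finset ι) (f : H), ∑ α ∈ s, ⟪f, h α⟫_ℝ ^ 2 ≤ ‖f‖ ^ 2) ∧
      ∀ (s : Finset ι) (x : X), ‖reproducingFun H x - ∑ α ∈ s, φ x α • h α‖ ^ 2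
        ≤ realKernel H x x - ∑ α ∈ s, φ x α ^ 2 := by
  classical
  have hmem (x : X) : Memℓp (φ x) 2 := by
    refine memℓp_gen ?_
    simpa [sq] using (hφ x x).summable
  let Φ : X → lp (fun _ : ι => ℝ) 2 := fun x => ⟨φ x, hmem x⟩
  have hΦ (x y : X) : ⟪Φ x, Φ y⟫_ℝ = realKernel H x y := by
    refine (lp.hasSum_inner (𝕜 := ℝ) (Φ x) (Φ y)).unique ?_
    simpa [Φ, mul_comm] using hφ x y
  obtain ⟨J, hJ, hJφ⟩ := exists_clm_reproducingFun_eq Φ hΦ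
  have hadj : ‖ContinuousLinearMap.adjoint J‖ ≤ 1 := by simpa using hJ
  have hadjφ (x : X) : ContinuousLinearMap.adjoint J (Φ x) = reproducingFun H x := by
    refine DFunLike.ext _ _ fun y => ?_
    rw [← inner_reproducingFun, ContinuousLinearMap.adjoint_inner_left, hJφ, hΦ,
      ← inner_reproducingFun, inner_reproducingFun_reproducingFun, ← hΦ, real_inner_comm, hΦ]
  refine ⟨fun α => ContinuousLinearMap.adjoint J (lp.single 2 α 1), fun s f => ?_, fun s x => ?_⟩
  · have hsum := lp.sum_rpow_le_norm_rpow (p := 2) (by norm_num) (J f) s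
    have hle : ‖J f‖ ≤ ‖f‖ := by simpa using J.le_of_opNorm_le hJ f
    simp only [ENNReal.toReal_ofNat, Real.rpow_ofNat, Real.norm_eq_abs, sq_abs] at hsum
    refine le_trans (le_of_eq ?_) (hsum.trans (pow_le_pow_left₀ (norm_nonneg _) hle 2))
    refine Finset.sum_congr rfl fun α _ => ?_
    rw [ContinuousLinearMap.adjoint_inner_right, lp.inner_single_right]
    simp
  · have hsum := lp.norm_compl_sum_single (p := 2) (by norm_num) (Φ x) s
    simp only [ENNReal.toReal_ofNat, Real.rpow_ofNat, Real.norm_eq_abs, sq_abs] at hsum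
    rw [← real_inner_self_eq_norm_sq (Φ x), hΦ] at hsum
    have heq : reproducingFun H x - ∑ α ∈ s, φ x α • ContinuousLinearMap.adjoint J (lp.single 2 α 1)
        = ContinuousLinearMap.adjoint J (Φ x - ∑ α ∈ s, lp.single 2 α (Φ x α)) := by
      rw [map_sub, map_sum, hadjφ]
      congr 1
      refine Finset.sum_congr rfl fun α _ => ?_
      rw [← map_smul, ← lp.single_smul, smul_eq_mul, mul_one]
    rw [heq]
    refine le_trans (pow_le_pow_left₀ (norm_nonneg _) ?_ 2) hsum.le
    exact ((ContinuousLinearMap.adjoint J).le_of_opNorm_le hadj _).trans_eq (one_mul _)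

end Features

/-! ### Compressions of Hilbert–Schmidt operators -/

theorem ofReal_norm_sq_eq_enorm_sq {E : Type*} [NormedAddCommGroup E] (x : E) :
    ENNReal.ofReal (‖x‖ ^ 2) = ‖x‖ₑ ^ 2 := by
  rw [ENNReal.ofReal_pow (norm_nonneg _), ofReal_norm]

/-- The dual form of Bessel's inequality: synthesis along `h` is a contraction. -/
theorem norm_sum_smul_le_one {H ι : Type*} [NormedAddCommGroup H]
    [InnerProductSpace ℝ H] {s : Finset ι} {h : ι → H}
    {c : ι → ℝ} (hh : ∀ f : H, ∑ α ∈ s, ⟪f, h α⟫_ℝ ^ 2 ≤ ‖f‖ ^ 2)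
    (hc : ∑ α ∈ s, c α ^ 2 ≤ 1) :
    ‖∑ α ∈ s, c α • h α‖ ≤ 1 := by
  set p := ∑ α ∈ s, c α • h α with hp
  have h1 : ‖p‖ ^ 2 = ∑ α ∈ s, c α * ⟪p, h α⟫_ℝ := by
    rw [← real_inner_self_eq_norm_sq]
    nth_rw 2 [hp]
    simp [inner_sum, real_inner_smul_right]
  have h2 : (‖p‖ ^ 2) ^ 2 ≤ 1 * ‖p‖ ^ 2 := by
    rw [h1]
    refine (Finset.sum_mul_sq_le_sq_mul_sq _ _ _).trans ?_
    rw [← h1]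
    exact mul_le_mul hc (hh p) (Finset.sum_nonneg fun _ _ => sq_nonneg _) zero_le_one
  rw [← sq_le_one_iff₀ (norm_nonneg _)]
  nlinarith [sq_nonneg ‖p‖]

section Compression

variable {H : Type*} [NormedAddCommGroup H] [InnerProductSpace ℝ H] [CompleteSpace H]

/-- For a family `h` with Bessel's inequality, `T ↦ (T (h α))` is bounded by the Hilbert–Schmidt
norm. The inequality is applied to the vectors `T† (b i)`, where `b` is a Hilbert basis. -/
theorem HilbertSchmidt.sum_norm_apply_sq_le {ι : Type*} {s : Finset ι} {h : ι → H}
    (hh : ∀ f : H, ∑ α ∈ s, ⟪f, h α⟫_ℝ ^ 2 ≤ ‖f‖ ^ 2) (T : HilbertSchmidt H) :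
    ∑ α ∈ s, ‖toCLM H T (h α)‖ ^ 2 ≤ ‖T‖ ^ 2 := by
  set b := hsBasis H
  rw [← ENNReal.ofReal_le_ofReal_iff (by positivity), ENNReal.ofReal_sum_of_nonneg
    (fun _ _ => by positivity), ofReal_norm_sq_eq_enorm_sq, HilbertSchmidt.enorm_sq_eq H b,
    hsSqSum_eq_adjoint b b]
  calc ∑ α ∈ s, ENNReal.ofReal (‖toCLM H T (h α)‖ ^ 2)
      = ∑ α ∈ s, ∑' i, ‖⟪toCLM H T (h α), b i⟫_ℝ‖ₑ ^ 2 :=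
        Finset.sum_congr rfl fun α _ => by
          rw [ofReal_norm_sq_eq_enorm_sq, enorm_sq_eq_tsum_inner b]
    _ = ∑' i, ∑ α ∈ s, ‖⟪toCLM H T (h α), b i⟫_ℝ‖ₑ ^ 2 :=
        (Summable.tsum_finsetSum fun _ _ => ENNReal.summable).symm
    _ ≤ hsSqSum b (ContinuousLinearMap.adjoint (toCLM H T)) := by
        refine ENNReal.tsum_le_tsum fun i => ?_
        have := ENNReal.ofReal_le_ofReal (hh (ContinuousLinearMap.adjoint (toCLM H T) (b i)))
        rw [ENNReal.ofReal_sum_of_nonneg (fun _ _ => by positivity),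
          ofReal_norm_sq_eq_enorm_sq] at this
        refine le_trans (Finset.sum_le_sum fun α _ => ?_) this
        rw [← sq_abs, ← Real.norm_eq_abs, ofReal_norm_sq_eq_enorm_sq,
          ContinuousLinearMap.adjoint_inner_left, real_inner_comm]

theorem HilbertSchmidt.norm_toCLM_apply_le (T : HilbertSchmidt H) (x : H) :
    ‖toCLM H T x‖ ≤ ‖T‖ * ‖x‖ := by
  rcases eq_or_ne x 0 with rfl | hx
  · simp
  have hx' : ‖x‖ ≠ 0 := norm_ne_zero_iff.2 hx
  -- A single unit vector is a family with Bessel's inequality.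
  have hle := sum_norm_apply_sq_le (s := {()}) (h := fun _ => ‖x‖⁻¹ • x) (fun f => by
    rw [Finset.sum_singleton, ← sq_abs]
    refine pow_le_pow_left₀ (abs_nonneg _) ((abs_real_inner_le_norm _ _).trans_eq ?_) 2
    rw [norm_smul, norm_inv, norm_norm, inv_mul_cancel₀ hx', mul_one]) T
  rw [Finset.sum_singleton, sq_le_sq₀ (norm_nonneg _) (norm_nonneg _), map_smul, norm_smul,
    norm_inv, norm_norm] at hle
  rwa [inv_mul_le_iff₀ (by positivity), mul_comm] at hle

/-- The matrix `⟪T (h β), h α⟫` of `T` along a finite family `h`, as a point of Euclidean space. -/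
noncomputable def HilbertSchmidt.compression {ι : Type*} (s : Finset ι) (h : ι → H) :
    HilbertSchmidt H →ₗ[ℝ] EuclideanSpace ℝ (s × s) where
  toFun T := WithLp.toLp 2 fun p => ⟪toCLM H T (h p.1), h p.2⟫_ℝ
  map_add' S T := by ext p; simp [inner_add_left]
  map_smul' c T := by ext p; simp [inner_smul_left]

theorem HilbertSchmidt.norm_compression_le {ι : Type*} {s : Finset ι} {h : ι → H}
    (hh : ∀ f : H, ∑ α ∈ s, ⟪f, h α⟫_ℝ ^ 2 ≤ ‖f‖ ^ 2) (T : HilbertSchmidt H) :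
    ‖compression s h T‖ ≤ ‖T‖ := by
  rw [← sq_le_sq₀ (norm_nonneg _) (norm_nonneg _), EuclideanSpace.real_norm_sq_eq,
    Fintype.sum_prod_type]
  refine le_trans ?_ (sum_norm_apply_sq_le hh T)
  rw [← Finset.sum_coe_sort s]
  refine Finset.sum_le_sum fun α _ => le_of_eq_of_le ?_ (hh (toCLM H T (h α)))
  rw [← Finset.sum_coe_sort s]
  rfl

/-- The quadratic form of `T` on the span of `h` is controlled by the compression of `T`. -/
theorem HilbertSchmidt.abs_inner_sum_smul_le {ι : Type*} (s : Finset ι) (h : ι → H) (c : ι → ℝ)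
    (hc : ∑ α ∈ s, c α ^ 2 ≤ 1) (T : HilbertSchmidt H) :
    |⟪toCLM H T (∑ α ∈ s, c α • h α), ∑ α ∈ s, c α • h α⟫_ℝ| ≤ ‖compression s h T‖ := by
  have heq : ⟪toCLM H T (∑ α ∈ s, c α • h α), ∑ α ∈ s, c α • h α⟫_ℝ
      = ∑ p : s × s, compression s h T p * (c p.1 * c p.2) := by
    simp only [map_sum, map_smul, sum_inner, inner_sum, real_inner_smul_left,
      real_inner_smul_right, Fintype.sum_prod_type]
    rw [Finset.sum_comm, ← Finset.sum_coe_sort s]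
    refine Finset.sum_congr rfl fun α _ => ?_
    rw [← Finset.sum_coe_sort s]
    refine Finset.sum_congr rfl fun β _ => ?_
    simp only [compression, LinearMap.coe_mk, AddHom.coe_mk]
    ring
  have hcc : ∑ p : s × s, (c p.1 * c p.2) ^ 2 ≤ 1 := by
    simp only [mul_pow, Fintype.sum_prod_type, ← Finset.mul_sum, ← Finset.sum_mul]
    rw [Finset.sum_coe_sort s fun α => c α ^ 2]
    exact mul_le_one₀ hc (Finset.sum_nonneg fun _ _ => sq_nonneg _) hc
  rw [heq]
  refine abs_le_of_sq_le_sq ?_ (norm_nonneg _)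
  refine (Finset.sum_mul_sq_le_sq_mul_sq _ _ _).trans ?_
  rw [EuclideanSpace.real_norm_sq_eq]
  exact mul_le_of_le_one_right (Finset.sum_nonneg fun _ _ => sq_nonneg _) hcc

end Compression

/-! ### Covering numbers for a kernel with finitely many dominant features -/

section CoveringBound

variable {H X : Type*} [NormedAddCommGroup H] [InnerProductSpace ℝ H] [CompleteSpace H]
  [RKHS ℝ H X ℝ]

theorem norm_reproducingFun_le_one {x : X} (hK : realKernel H x x ≤ 1) :
    ‖reproducingFun H x‖ ≤ 1 := by
  rwa [← sq_le_one_iff₀ (norm_nonneg _), ← real_inner_self_eq_norm_sq,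
    inner_reproducingFun_reproducingFun]

theorem hsStarCoveringNumber_le_encard {ε : ℝ} {V : Set (HilbertSchmidt H)}
    (hV : ∀ T : HilbertSchmidt H, ‖T‖ ≤ 1 →
      ∃ v ∈ V, starNorm (HilbertSchmidt.toCLM H (v - T)) ≤ ε) :
    hsStarCoveringNumber H ε ≤ V.encard :=
  iInf₂_le V hV

/-- For `ε ≥ 1` the zero operator alone is an `ε`-net. -/
theorem hsStarCoveringNumber_le_one {ε : ℝ} (hε : 1 ≤ ε)
    (hK : ∀ x : X, realKernel H x x ≤ 1) : hsStarCoveringNumber H ε ≤ 1 := by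
  rw [← Set.encard_singleton (0 : HilbertSchmidt H)]
  refine hsStarCoveringNumber_le_encard fun T hT => ⟨0, rfl, ?_⟩
  refine Real.iSup_le (fun x => ?_) (by linarith)
  have hx := norm_reproducingFun_le_one (hK x)
  have hT' : ‖(0 - T : HilbertSchmidt H)‖ ≤ 1 := by rwa [zero_sub, norm_neg]
  refine (abs_real_inner_le_norm _ _).trans (le_trans ?_ hε)
  refine mul_le_one₀ ?_ (norm_nonneg _) hx
  exact (HilbertSchmidt.norm_toCLM_apply_le _ _).trans (mul_le_one₀ hT' (norm_nonneg _) hx)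

/-- If every reproducing function is `ε / 8`-close to a combination, with coefficients in the unit
ball, of a finite family `h` with Bessel's inequality, then an `ε / 2`-net of the compressions to
`h` of the unit ball of Hilbert–Schmidt operators lifts to an `ε`-net for `‖·‖_*`. -/
theorem hsStarCoveringNumber_le_of_approx {ι : Type*} {s : Finset ι} {h : ι → H}
    {φ : X → ι → ℝ} {ε : ℝ} (hε : 0 < ε) (hK : ∀ x : X, realKernel H x x ≤ 1)
    (hh : ∀ f : H, ∑ α ∈ s, ⟪f, h α⟫_ℝ ^ 2 ≤ ‖f‖ ^ 2) (hφ : ∀ x, ∑ α ∈ s, φ x α ^ 2 ≤ 1)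
    (happ : ∀ x, ‖reproducingFun H x - ∑ α ∈ s, φ x α • h α‖ ≤ ε / 8) :
    hsStarCoveringNumber H ε ≠ ⊤ ∧
      ((hsStarCoveringNumber H ε).toNat : ℝ) ≤ (1 + 4 / ε) ^ (s.card ^ 2) := by
  set A := HilbertSchmidt.compression s h
  obtain ⟨C, hCS, hCfin, hCcard, hC⟩ := exists_finite_net_of_subset_unitBall (half_pos hε)
    (A '' {T | ‖T‖ ≤ 1}) (by
      rintro _ ⟨T, hT, rfl⟩
      exact (HilbertSchmidt.norm_compression_le hh T).trans hT)
  obtain ⟨V, hV, hVC⟩ := Set.SurjOn.exists_bijOn_subset hCS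
  obtain rfl := hVC.image_eq
  have hle : hsStarCoveringNumber H ε ≤ V.encard := by
    refine hsStarCoveringNumber_le_encard fun T hT => ?_
    obtain ⟨_, ⟨v, hv, rfl⟩, hvT⟩ := hC (A T) ⟨T, hT, rfl⟩
    refine ⟨v, hv, Real.iSup_le (fun x => ?_) hε.le⟩
    rw [← map_sub] at hvT
    set S := v - T
    -- The net consists of images of points of the unit ball, which bounds `v - T`.
    have hv1 : ‖v‖ ≤ 1 := hV hv
    have hS : ‖S‖ ≤ 2 := (norm_sub_le v T).trans (by linarith)
    set k := reproducingFun H x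
    set p := ∑ α ∈ s, φ x α • h α
    have hk : ‖k‖ ≤ 1 := norm_reproducingFun_le_one (hK x)
    have hp : ‖p‖ ≤ 1 := norm_sum_smul_le_one hh (hφ x)
    have hsplit : ⟪HilbertSchmidt.toCLM H S k, k⟫_ℝ = ⟪HilbertSchmidt.toCLM H S p, p⟫_ℝ
        + ⟪HilbertSchmidt.toCLM H S (k - p), k⟫_ℝ + ⟪HilbertSchmidt.toCLM H S p, k - p⟫_ℝ := by
      simp only [map_sub, inner_sub_left, inner_sub_right]
      ring
    have h1 : |⟪HilbertSchmidt.toCLM H S p, p⟫_ℝ| ≤ ε / 2 :=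
      (HilbertSchmidt.abs_inner_sum_smul_le s h (φ x) (hφ x) S).trans hvT
    have hbound (u w : H) : |⟪HilbertSchmidt.toCLM H S u, w⟫_ℝ| ≤ 2 * ‖u‖ * ‖w‖ := by
      refine (abs_real_inner_le_norm _ _).trans ?_
      gcongr
      exact (HilbertSchmidt.norm_toCLM_apply_le S u).trans (by gcongr)
    have h2 : |⟪HilbertSchmidt.toCLM H S (k - p), k⟫_ℝ| ≤ ε / 4 :=
      (hbound _ _).trans (by nlinarith [happ x, norm_nonneg (k - p), norm_nonneg k])
    have h3 : |⟪HilbertSchmidt.toCLM H S p, k - p⟫_ℝ| ≤ ε / 4 :=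
      (hbound _ _).trans (by nlinarith [happ x, norm_nonneg (k - p), norm_nonneg p])
    rw [hsplit]
    exact (abs_add_three _ _ _).trans (by linarith)
  rw [← hVC.injOn.encard_image, ← hCfin.cast_ncard_eq] at hle
  have hne := ne_top_of_le_ne_top (ENat.natCast_ne_top _) hle
  refine ⟨hne, le_trans ?_ (hCcard.trans_eq ?_)⟩
  · exact_mod_cast ENat.toNat_le_of_le_natCast hle
  · rw [finrank_euclideanSpace, Fintype.card_prod, Fintype.card_coe, sq]
    congr 2
    field_simp
    norm_num

end CoveringBound

/-! ### The Gaussian kernel -/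

theorem mainTheorem5 {H : Type*} [NormedAddCommGroup H] [InnerProductSpace ℝ H] [CompleteSpace H]
    (d : ℕ) [RKHS ℝ H (Metric.closedBall (0 : EuclideanSpace ℝ (Fin d)) 1) ℝ]
    (η ε : ℝ) (hη : 0 ≤ η) (hε : 0 < ε)
    (hK : ∀ x y : Metric.closedBall (0 : EuclideanSpace ℝ (Fin d)) 1,
      realKernel H x y
        = Real.exp (-η * ‖(x : EuclideanSpace ℝ (Fin d)) - (y : EuclideanSpace ℝ (Fin d))‖ ^ 2)) :
    hsStarCoveringNumber H ε ≠ ⊤ ∧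
      Real.log ((hsStarCoveringNumber H ε).toNat : ℝ) ≤
        (⌈2 * (Real.log (2 * √2 / ε) + Real.exp 1 ^ 2 * η)⌉ : ℝ) ^ (2 * d)
          * Real.log (1 + 4 / ε) := by
  have hK1 (x : Metric.closedBall (0 : EuclideanSpace ℝ (Fin d)) 1) : realKernel H x x = 1 := by
    simp [hK]
  rcases le_or_gt 1 ε with hε1 | hε1
  · -- One point suffices, and the right-hand side is nonnegative because `2 * d` is even.
    have hle := hsStarCoveringNumber_le_one (H := H) hε1 fun x => (hK1 x).le
    refine ⟨ne_top_of_le_ne_top ENat.one_ne_top hle, ?_⟩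
    have hnat : ((hsStarCoveringNumber H ε).toNat : ℝ) ≤ 1 := by
      exact_mod_cast ENat.toNat_le_of_le_natCast (n := 1) hle
    refine (Real.log_nonpos (Nat.cast_nonneg _) hnat).trans (mul_nonneg ?_ (Real.log_nonneg ?_))
    · exact (even_two_mul d).pow_nonneg _
    · exact le_add_of_nonneg_right (by positivity)
  set L := Real.log (2 * √2 / ε) + Real.exp 1 ^ 2 * η with hL
  have hsqrt : 1 ≤ √2 := Real.one_le_sqrt.2 one_le_two
  have hL0 : 0 ≤ L := by
    refine add_nonneg (Real.log_nonneg ?_) (by positivity)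
    rw [le_div_iff₀ hε]
    linarith
  obtain ⟨n, hn⟩ := Int.eq_ofNat_of_zero_le (Int.ceil_nonneg (by positivity : 0 ≤ 2 * L))
  have hnL : 2 * L ≤ n := by
    have := Int.le_ceil (2 * L)
    rwa [hn] at this
  -- The tail beyond degree `n` is at most `(ε² / 8)²`.
  have htail : Real.exp (2 * (Real.exp 1 ^ 2 * η) - 2 * n) ≤ (ε / 8) ^ 2 := by
    have hexp : Real.exp (-Real.log (2 * √2 / ε)) = ε / (2 * √2) := by
      rw [Real.exp_neg, Real.exp_log (by positivity), inv_div]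
    calc Real.exp (2 * (Real.exp 1 ^ 2 * η) - 2 * n)
        ≤ Real.exp ((4 : ℕ) * -Real.log (2 * √2 / ε)) := by
          have : 0 ≤ Real.exp 1 ^ 2 * η := by positivity
          refine Real.exp_le_exp.2 ?_
          push_cast
          linarith
      _ = (ε / 8) ^ 2 * ε ^ 2 := by
          rw [Real.exp_nat_mul, hexp]
          have : √2 ^ 4 = 4 := by
            rw [show √2 ^ 4 = (√2 ^ 2) ^ 2 by ring, Real.sq_sqrt zero_le_two]
            norm_num
          rw [div_pow, mul_pow, this]
          ring
      _ ≤ (ε / 8) ^ 2 := mul_le_of_le_one_right (by positivity) (pow_le_one₀ hε.le hε1.le)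
  set B := Fintype.piFinset fun _ : Fin d => Finset.range n with hB
  have hker (x y : Metric.closedBall (0 : EuclideanSpace ℝ (Fin d)) 1) :
      HasSum (fun α => gaussFeature η (x : EuclideanSpace ℝ (Fin d)) α
        * gaussFeature η (y : EuclideanSpace ℝ (Fin d)) α) (realKernel H x y) := by
    rw [hK]
    exact hasSum_gaussFeature_mul hη _ _
  obtain ⟨h, hbessel, happ⟩ := exists_bessel_family_of_hasSum_kernel _ hker
  obtain ⟨hfin, hcard⟩ := hsStarCoveringNumber_le_of_approx (s := B) hε (fun x => (hK1 x).le)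
    (hbessel B) (fun x => by
      have hsum := (hker x x).summable.sum_le_tsum B fun α _ => mul_self_nonneg _
      rw [(hker x x).tsum_eq, hK1] at hsum
      simpa only [sq] using hsum)
    (fun x => by
      refine le_of_sq_le_sq ?_ (by positivity)
      refine (happ B x).trans (le_trans ?_ htail)
      rw [hK1]
      exact one_sub_sum_gaussFeature_sq_le hη (mem_closedBall_zero_iff.1 x.2) n)
  refine ⟨hfin, ?_⟩
  have hBcard : B.card ^ 2 = n ^ (2 * d) := by
    rw [hB, Fintype.card_piFinset_const, Finset.card_range, ← pow_mul, mul_comm]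
  rw [hBcard] at hcard
  rw [hn]
  rcases Nat.eq_zero_or_pos (hsStarCoveringNumber H ε).toNat with h0 | hpos
  · rw [h0, Nat.cast_zero, Real.log_zero]
    exact mul_nonneg (by positivity) (Real.log_nonneg (le_add_of_nonneg_right (by positivity)))
  · refine (Real.log_le_log (by exact_mod_cast hpos) hcard).trans_eq ?_
    rw [Real.log_pow]
    push_cast
    rfl
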